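/- Let $\mathcal W_4=\{x\in\mathbb R^4: x_1<x_2<x_3<x_4\}$, with closure $\overline{\mathcal W_4}=\{x_1\le x_2\le x_3\le x_4\}$, let $\Phi(x)=\max_i x_i$, let $x^{(1)}\le x^{(2)}\le x^{(3)}\le x^{(4)}$ denote the ranked coordinates of $x\in\mathbb R^4$, and for $x\in\mathcal W_4$ let $$\begin{aligned}U(x)={}&x_4-\tfrac{\sqrt2}{4}\sinh\big(\sqrt2(x_4-x_3)\big)\\&+\tfrac{\sqrt2}{2}\arctan\!\Big(e^{\frac{x_1+x_2-x_3-x_4}{\sqrt2}}\Big)\cosh\!\Big(\tfrac{x_1-x_2+x_3-x_4}{\sqrt2}\Big)\cosh\!\Big(\tfrac{-x_1+x_2+x_3-x_4}{\sqrt2}\Big)\cosh\!\Big(\tfrac{-x_1-x_2+x_3+x_4}{\sqrt2}\Big)\\&+\tfrac{\sqrt2}{2}\operatorname{arctanh}\!\Big(e^{\frac{x_1+x_2-x_3-x_4}{\sqrt2}}\Big)\sinh\!\Big(\tfrac{x_1-x_2+x_3-x_4}{\sqrt2}\Big)\sinh\!\Big(\tfrac{-x_1+x_2+x_3-x_4}{\sqrt2}\Big)\sinh\!\Big(\tfrac{-x_1-x_2+x_3+x_4}{\sqrt2}\Big).\end{aligned}$$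 Let $u(x)$, for $x\in\mathbb R^4$, be given by the same expression evaluated at $(x^{(1)},x^{(2)},x^{(3)},x^{(4)})$, where the last summand is read as $0$ when all coordinates of $x$ are equal. Then: 1. $U$ has a $C^2$ extension to $\overline{\mathcal W_4}$, still denoted $U$, and for $i=1,2,3$ and every $x\in\overline{\mathcal W_4}$ with $x_i=x_{i+1}$ it satisfies $\partial_iU(x)=\partial_{i+1}U(x)$. Moreover $u(x)=U(x^{(1)},x^{(2)},x^{(3)},x^{(4)})$ for all $x\in\mathbb R^4$. 2. $u$ is $C^2$ on $\mathbb R^4$. 3. For all $x\in\mathcal W_4$, with $e_{\{2,4\}}=(0,1,0,1)^\top$ and $\partial^2U$ the Hessian matrix of $U$, $$U(x)-\Phi(x)-\tfrac12\,e_{\{2,4\}}^\top\,\partial^2U(x)\,e_{\{2,4\}}=0 .$$ -/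

import Mathlib

open scoped Matrix

noncomputable section

/-- The open Weyl chamber `x₁ < x₂ < x₃ < x₄` of `ℝ⁴` (coordinates are indexed from `0`). -/
def weylChamber : Set (Fin 4 → ℝ) :=
  {x | x 0 < x 1 ∧ x 1 < x 2 ∧ x 2 < x 3}

/-- The explicit expression of `U`, which is meant on the open chamber. Its only term that is
undefined somewhere on the closed chamber is `artanh (exp 0)` at the points `x₁ = x₂ = x₃ = x₄`;
there it is multiplied by `sinh 0 = 0`, so the value that Mathlib gives to `artanh 1` is
irrelevant. -/
def chamberU (x : Fin 4 → ℝ) : ℝ :=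
  x 3 - √2 / 4 * Real.sinh (√2 * (x 3 - x 2))
    + √2 / 2 * Real.arctan (Real.exp ((x 0 + x 1 - x 2 - x 3) / √2))
        * Real.cosh ((x 0 - x 1 + x 2 - x 3) / √2)
        * Real.cosh ((-x 0 + x 1 + x 2 - x 3) / √2)
        * Real.cosh ((-x 0 - x 1 + x 2 + x 3) / √2)
    + √2 / 2 * Real.artanh (Real.exp ((x 0 + x 1 - x 2 - x 3) / √2))
        * Real.sinh ((x 0 - x 1 + x 2 - x 3) / √2)
        * Real.sinh ((-x 0 + x 1 + x 2 - x 3) / √2)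
        * Real.sinh ((-x 0 - x 1 + x 2 + x 3) / √2)

/-- The ranked coordinates `x⁽¹⁾ ≤ x⁽²⁾ ≤ x⁽³⁾ ≤ x⁽⁴⁾` of `x`. -/
def ranked (x : Fin 4 → ℝ) : Fin 4 → ℝ := x ∘ Tuple.sort x

/-- The symmetrized function `u(x) = U(x⁽¹⁾, x⁽²⁾, x⁽³⁾, x⁽⁴⁾)` on `ℝ⁴`. -/
def symmU (x : Fin 4 → ℝ) : ℝ := chamberU (ranked x)

/-- `Φ(x) = maxᵢ xᵢ`. -/
def maxCoord (x : Fin 4 → ℝ) : ℝ := Finset.univ.sup' Finset.univ_nonempty x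

/-- The partial derivative `∂ᵢ f (x)`, where `f` is differentiated as a function on `S`. -/
def partialWithin (S : Set (Fin 4 → ℝ)) (f : (Fin 4 → ℝ) → ℝ) (i : Fin 4) (x : Fin 4 → ℝ) : ℝ :=
  fderivWithin ℝ f S x (Pi.single i 1)

/-- The Hessian matrix `∂² f (x)`. -/
def hessianMatrix (f : (Fin 4 → ℝ) → ℝ) (x : Fin 4 → ℝ) : Matrix (Fin 4) (Fin 4) ℝ :=
  Matrix.of fun i j =>
    fderiv ℝ (fun y => fderiv ℝ f y (Pi.single j 1)) x (Pi.single i 1)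

/-- The vector `e_J = ∑_{j ∈ J} e_j`. -/
def indicatorVec (J : Finset (Fin 4)) : Fin 4 → ℝ := ∑ j ∈ J, Pi.single j 1

end

open Filter Topology

/-! The product formulas for cosh and sinh turn `chamberU` into `valueForm`, a sum over `k` whose
terms involve the forms `dev k`. A permutation of the coordinates permutes these forms, so only
`lowGap` and `topGap` depend on the ranking. Since the derivatives of arctan(exp w) and artanh(exp
w) are 1/(2 cosh w) and -1/(2 sinh w), differentiating these factors leaves elementary terms, and
the gradient and Hessian get the closed forms `gradForm` and `hessForm`.

On the closed chamber the only singularity is at `lowGap x = 0`, where all coordinates agree. There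
every artanh factor meets something of order `lowGap`, so value, gradient and Hessian are continuous
up to the boundary.

The ranking-dependent terms vanish where the ranking is ambiguous: cosh(`topGap`) - 1 and
sinh(`topGap`) at a tie of the two largest coordinates, and `wallTerm` at a tie of the two middle
ones (`wallTerm_eq_zero`). Hence both forms extend equivariantly to the whole space, and the 24
cells glue (`hasFDerivAt_of_hasFDerivWithinAt_comp_perm`). This gives the C² claim; the wall
conditions follow by swapping equal coordinates, and the equation is read off from `hessForm`. -/

/-! ### Calculus of arctan(exp w) and artanh(exp w) -/

theorem hasDerivAt_arctan_exp (w : ℝ) :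
    HasDerivAt (fun w => Real.arctan (Real.exp w)) (1 / (2 * Real.cosh w)) w := by
  convert (Real.hasDerivAt_exp w).arctan using 1
  rw [Real.cosh_eq, Real.exp_neg]
  have := Real.exp_pos w
  field_simp
  ring

theorem hasDerivAt_artanh_exp {w : ℝ} (hw : w < 0) :
    HasDerivAt (fun w => Real.artanh (Real.exp w)) (-1 / (2 * Real.sinh w)) w := by
  have hE : ∀ y : ℝ, y < 0 → 0 < 1 - Real.exp y := fun y hy => by
    have := Real.exp_lt_one_iff.2 hy
    linarith
  have h1 : HasDerivAt (fun w => 1 / 2 * (Real.log (1 + Real.exp w) - Real.log (1 - Real.exp w)))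
      (1 / 2 * (Real.exp w / (1 + Real.exp w) - (-Real.exp w) / (1 - Real.exp w))) w := by
    have hp : 1 + Real.exp w ≠ 0 := by positivity
    exact ((((Real.hasDerivAt_exp w).const_add 1).log hp).sub
      (((Real.hasDerivAt_exp w).const_sub 1).log (hE w hw).ne')).const_mul _
  have h2 : (fun w => Real.artanh (Real.exp w)) =ᶠ[𝓝 w]
      fun w => 1 / 2 * (Real.log (1 + Real.exp w) - Real.log (1 - Real.exp w)) := by
    filter_upwards [Iio_mem_nhds hw] with y hy
    have := hE y hy
    have h0 := Real.exp_pos y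
    rw [Real.artanh_eq_half_log ⟨by linarith, by linarith⟩, Real.log_div (by positivity) this.ne']
  refine (h1.congr_of_eventuallyEq h2).congr_deriv ?_
  have h3 := hE w hw
  have h4 : Real.exp w ^ 2 - 1 ≠ 0 := by nlinarith [Real.exp_pos w]
  have h5 : 1 - Real.exp w ≠ 0 := h3.ne'
  have h6 : Real.exp w - (Real.exp w)⁻¹ ≠ 0 := by
    have : (Real.exp w) ≠ 0 := (Real.exp_pos w).ne'
    intro h
    field_simp at h
    apply h4
    linarith
  rw [Real.sinh_eq, Real.exp_neg]
  have := Real.exp_pos w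
  have h7 : (1 + Real.exp w) ≠ 0 := by positivity
  field_simp
  ring

/-- The product `artanh (exp w) * sinh w` tends to zero at `w = 0`, with an explicit bound. -/
theorem sq_artanh_exp_mul_sinh_le {w : ℝ} (hw : w ≤ 0) :
    (Real.artanh (Real.exp w) * Real.sinh w) ^ 2
      ≤ (1 - Real.exp w) * (1 + Real.exp w) ^ 3 / (4 * Real.exp w ^ 2) := by
  rcases hw.eq_or_lt with rfl | hw
  · simp
  have hE := Real.exp_pos w
  have h1 : 0 < 1 - Real.exp w := by linarith [Real.exp_lt_one_iff.2 hw]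
  have h0 : 0 ≤ Real.artanh (Real.exp w) := Real.artanh_nonneg hE.le
  have hB : Real.artanh (Real.exp w) ^ 2 ≤ (1 + Real.exp w) / (1 - Real.exp w) := by
    -- artanh is by definition the logarithm of this square root, and log y ≤ y is enough.
    have : Real.artanh (Real.exp w) ≤ √((1 + Real.exp w) / (1 - Real.exp w)) :=
      Real.log_le_self (Real.sqrt_nonneg _)
    calc _ ≤ √((1 + Real.exp w) / (1 - Real.exp w)) ^ 2 := by gcongr
      _ = _ := Real.sq_sqrt (by positivity)
  rw [mul_pow]
  calc _ ≤ (1 + Real.exp w) / (1 - Real.exp w) * Real.sinh w ^ 2 := by gcongr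
    _ = _ := by
      rw [Real.sinh_eq, Real.exp_neg]
      field_simp
      ring

theorem tendsto_artanh_exp_mul_sinh :
    Tendsto (fun w => Real.artanh (Real.exp w) * Real.sinh w) (𝓝[≤] 0) (𝓝 0) := by
  have h : Tendsto (fun w => (1 - Real.exp w) * (1 + Real.exp w) ^ 3 / (4 * Real.exp w ^ 2))
      (𝓝[≤] 0) (𝓝 0) := by
    have : ContinuousAt (fun w => (1 - Real.exp w) * (1 + Real.exp w) ^ 3 / (4 * Real.exp w ^ 2))
        0 := by
      apply ContinuousAt.div (by fun_prop) (by fun_prop)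
      simp
    have h' := this.tendsto
    simp only [Real.exp_zero, sub_self, zero_mul, zero_div] at h'
    exact h'.mono_left nhdsWithin_le_nhds
  have h2 : Tendsto (fun w => (Real.artanh (Real.exp w) * Real.sinh w) ^ 2) (𝓝[≤] 0) (𝓝 0) :=
    squeeze_zero' (Eventually.of_forall fun _ => sq_nonneg _)
      (eventually_nhdsWithin_of_forall fun w hw => sq_artanh_exp_mul_sinh_le hw) h
  have h3 := h2.sqrt
  simp only [Real.sqrt_sq_eq_abs, Real.sqrt_zero] at h3
  exact (tendsto_zero_iff_abs_tendsto_zero _).2 h3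

/-! ### Linear forms in the coordinates -/

/-- The coordinate `x_k` as a linear form. -/
noncomputable def coord (k : Fin 4) : (Fin 4 → ℝ) →L[ℝ] ℝ := ContinuousLinearMap.proj k

@[simp]
theorem coord_apply (k : Fin 4) (x : Fin 4 → ℝ) : coord k x = x k := rfl

/-- The linear forms `(x₁ + x₂ + x₃ + x₄ - 4 x_k) / √2`. -/
noncomputable def dev (k : Fin 4) : (Fin 4 → ℝ) →L[ℝ] ℝ :=
  (√2 / 2) • (∑ i, coord i - (4 : ℝ) • coord k)

theorem dev_apply (k : Fin 4) (x : Fin 4 → ℝ) : dev k x = √2 / 2 * (∑ i, x i - 4 * x k) := by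
  simp [dev]

/-- The linear form `(x₁ + x₂ - x₃ - x₄) / √2`. -/
noncomputable def lowGap : (Fin 4 → ℝ) →L[ℝ] ℝ :=
  (√2 / 2) • (coord 0 + coord 1
    - coord 2 - coord 3)

theorem lowGap_apply (x : Fin 4 → ℝ) : lowGap x = √2 / 2 * (x 0 + x 1 - x 2 - x 3) := by
  simp [lowGap]

/-- The linear form `(x₁ - x₂ + x₃ - x₄) / √2`. -/
noncomputable def crossGap : (Fin 4 → ℝ) →L[ℝ] ℝ :=
  (√2 / 2) • (coord 0 - coord 1
    + coord 2 - coord 3)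

theorem crossGap_apply (x : Fin 4 → ℝ) : crossGap x = √2 / 2 * (x 0 - x 1 + x 2 - x 3) := by
  simp [crossGap]

/-- The linear form `(-x₁ + x₂ + x₃ - x₄) / √2`. -/
noncomputable def innerGap : (Fin 4 → ℝ) →L[ℝ] ℝ :=
  (√2 / 2) • (-coord 0 + coord 1
    + coord 2 - coord 3)

theorem innerGap_apply (x : Fin 4 → ℝ) : innerGap x = √2 / 2 * (-x 0 + x 1 + x 2 - x 3) := by
  simp [innerGap]

/-- The linear form `√2 (x₄ - x₃)`. -/
noncomputable def topGap : (Fin 4 → ℝ) →L[ℝ] ℝ :=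
  √2 • (coord 3 - coord 2)

theorem topGap_apply (x : Fin 4 → ℝ) : topGap x = √2 * (x 3 - x 2) := by
  simp [topGap]

theorem topGap_eq (x : Fin 4 → ℝ) : topGap x = -(crossGap x + innerGap x) := by
  rw [topGap_apply, crossGap_apply, innerGap_apply]; ring

theorem dev_zero (x : Fin 4 → ℝ) : dev 0 x = -lowGap x - crossGap x + innerGap x := by
  rw [dev_apply, lowGap_apply, crossGap_apply, innerGap_apply, Fin.sum_univ_four]; ring

theorem dev_one (x : Fin 4 → ℝ) : dev 1 x = -lowGap x + crossGap x - innerGap x := by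
  rw [dev_apply, lowGap_apply, crossGap_apply, innerGap_apply, Fin.sum_univ_four]; ring

theorem dev_two (x : Fin 4 → ℝ) : dev 2 x = lowGap x - crossGap x - innerGap x := by
  rw [dev_apply, lowGap_apply, crossGap_apply, innerGap_apply, Fin.sum_univ_four]; ring

theorem dev_three (x : Fin 4 → ℝ) : dev 3 x = lowGap x + crossGap x + innerGap x := by
  rw [dev_apply, lowGap_apply, crossGap_apply, innerGap_apply, Fin.sum_univ_four]; ring

/-! ### Closed forms of value, gradient and Hessian -/

/-- The coefficient `1 - 4 δ_{ik}`. -/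
def coef (i k : Fin 4) : ℝ := if i = k then -3 else 1

/-- The signs `(1, 1, -1, -1)`. -/
def pairSign (i : Fin 4) : ℝ := if 2 ≤ i then -1 else 1

noncomputable def valueForm (x : Fin 4 → ℝ) : ℝ :=
  x 3 - √2 / 4 * Real.sinh (topGap x)
    + √2 / 8 * ∑ k, (Real.arctan (Real.exp (lowGap x)) * Real.cosh (dev k x)
        - Real.artanh (Real.exp (lowGap x)) * Real.sinh (dev k x))

/-- The partials of `dev k`, `lowGap`, `topGap` are √2/2 times `coef i k`, `pairSign i`, `pairSign i
- coef i 3`. The `pairSign` contributions cancel here, by `sum_dev_deriv_value`. -/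
noncomputable def gradForm (i : Fin 4) (x : Fin 4 → ℝ) : ℝ :=
  1 / 4 + 1 / 4 * (Real.cosh (topGap x) - 1) * coef i 3
    + 1 / 8 * ∑ k, coef i k * (Real.arctan (Real.exp (lowGap x)) * Real.sinh (dev k x)
        - Real.artanh (Real.exp (lowGap x)) * Real.cosh (dev k x))

/-- The coefficient of the only part of the Hessian that sees the split into two lower and two upper
coordinates. -/
noncomputable def wallTerm (x : Fin 4 → ℝ) : ℝ :=
  √2 / 8 * (Real.sinh (lowGap x) / Real.cosh (lowGap x) * Real.cosh (crossGap x)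
      * Real.cosh (innerGap x)
    + Real.cosh (lowGap x)
      * (Real.sinh (crossGap x) * Real.sinh (innerGap x) / Real.sinh (lowGap x))
    + Real.sinh (topGap x))

noncomputable def hessForm (i j : Fin 4) (x : Fin 4 → ℝ) : ℝ :=
  √2 / 16 * (∑ k, coef i k * coef j k
      * (Real.arctan (Real.exp (lowGap x)) * Real.cosh (dev k x)
        - Real.artanh (Real.exp (lowGap x)) * Real.sinh (dev k x)))
    - √2 / 8 * Real.sinh (topGap x) * (coef i 3 * coef j 3)
    + wallTerm x * (pairSign i * pairSign j)

theorem div_sqrt_two (y : ℝ) : y / √2 = √2 / 2 * y := by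
  have h : √2 * √2 = 2 := Real.mul_self_sqrt (by norm_num)
  have h0 : √2 ≠ 0 := by positivity
  field_simp
  linear_combination -y * h

theorem chamberU_eq_valueForm (x : Fin 4 → ℝ) : chamberU x = valueForm x := by
  have e : √2 / 2 * (-x 0 - x 1 + x 2 + x 3) = -lowGap x := by rw [lowGap_apply]; ring
  simp only [chamberU, valueForm, div_sqrt_two, ← lowGap_apply, ← crossGap_apply,
    ← innerGap_apply, ← topGap_apply, e, Fin.sum_univ_four, dev_zero, dev_one, dev_two, dev_three]
  simp only [Real.cosh_add, Real.sinh_add, sub_eq_add_neg, Real.cosh_neg, Real.sinh_neg]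
  ring

theorem sum_dev_deriv_value {x : Fin 4 → ℝ} (hx : lowGap x < 0) :
    ∑ k, (Real.cosh (dev k x) * (1 / (2 * Real.cosh (lowGap x)))
      - Real.sinh (dev k x) * (-1 / (2 * Real.sinh (lowGap x)))) = 2 * Real.cosh (topGap x) := by
  have hc : Real.cosh (lowGap x) ≠ 0 := (Real.cosh_pos _).ne'
  have hs : Real.sinh (lowGap x) ≠ 0 := (Real.sinh_neg_iff.2 hx).ne
  simp only [Fin.sum_univ_four, topGap_eq, dev_zero, dev_one, dev_two, dev_three]
  simp only [Real.cosh_add, Real.sinh_add, sub_eq_add_neg, Real.cosh_neg, Real.sinh_neg]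
  field_simp
  ring

theorem sum_dev_deriv_grad {x : Fin 4 → ℝ} (hx : lowGap x < 0) (i : Fin 4) :
    ∑ k, coef i k * (Real.sinh (dev k x) * (1 / (2 * Real.cosh (lowGap x)))
      - Real.cosh (dev k x) * (-1 / (2 * Real.sinh (lowGap x))))
    = 8 * √2 * wallTerm x * pairSign i - 2 * Real.sinh (topGap x) * coef i 3 := by
  have hc : Real.cosh (lowGap x) ≠ 0 := (Real.cosh_pos _).ne'
  have hs : Real.sinh (lowGap x) ≠ 0 := (Real.sinh_neg_iff.2 hx).ne
  have h2 : √2 * √2 = 2 := Real.mul_self_sqrt (by norm_num)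
  have hw : 8 * √2 * wallTerm x = 2 * (Real.sinh (lowGap x) / Real.cosh (lowGap x)
      * Real.cosh (crossGap x) * Real.cosh (innerGap x)
    + Real.cosh (lowGap x)
      * (Real.sinh (crossGap x) * Real.sinh (innerGap x) / Real.sinh (lowGap x))
    + Real.sinh (topGap x)) := by
    rw [wallTerm]
    linear_combination (Real.sinh (lowGap x) / Real.cosh (lowGap x)
      * Real.cosh (crossGap x) * Real.cosh (innerGap x)
    + Real.cosh (lowGap x)
      * (Real.sinh (crossGap x) * Real.sinh (innerGap x) / Real.sinh (lowGap x))
    + Real.sinh (topGap x)) * h2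
  rw [hw]
  simp only [Fin.sum_univ_four, topGap_eq, dev_zero, dev_one, dev_two, dev_three]
  simp only [Real.cosh_add, Real.sinh_add, sub_eq_add_neg, Real.cosh_neg, Real.sinh_neg, neg_add]
  fin_cases i <;> simp [coef, pairSign] <;> field_simp <;> ring

theorem hasFDerivAt_arctan_exp_lowGap (x : Fin 4 → ℝ) :
    HasFDerivAt (fun x => Real.arctan (Real.exp (lowGap x)))
      ((1 / (2 * Real.cosh (lowGap x))) • lowGap) x :=
  (hasDerivAt_arctan_exp (lowGap x)).comp_hasFDerivAt x lowGap.hasFDerivAt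

theorem hasFDerivAt_artanh_exp_lowGap {x : Fin 4 → ℝ} (hx : lowGap x < 0) :
    HasFDerivAt (fun x => Real.artanh (Real.exp (lowGap x)))
      ((-1 / (2 * Real.sinh (lowGap x))) • lowGap) x :=
  (hasDerivAt_artanh_exp hx).comp_hasFDerivAt x lowGap.hasFDerivAt

theorem hasFDerivAt_valueForm {x : Fin 4 → ℝ} (hx : lowGap x < 0) :
    HasFDerivAt valueForm (∑ j, gradForm j x • coord j) x := by
  have h2 : √2 * √2 = 2 := Real.mul_self_sqrt (by norm_num)
  have hA := hasFDerivAt_arctan_exp_lowGap x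
  have hB := hasFDerivAt_artanh_exp_lowGap hx
  have h := (((coord 3).hasFDerivAt (x := x)).sub
    ((topGap.hasFDerivAt (x := x)).sinh.const_mul (√2 / 4))).add
    ((HasFDerivAt.fun_sum (u := Finset.univ) fun k _ =>
      (hA.mul ((dev k).hasFDerivAt (x := x)).cosh).sub
        (hB.mul ((dev k).hasFDerivAt (x := x)).sinh)).const_mul (√2 / 8))
  refine h.congr_fderiv ?_
  have key := sum_dev_deriv_value hx
  ext1 v
  simp only [Fin.sum_univ_four] at key
  simp only [Fin.sum_univ_four, gradForm, add_apply,
    sub_apply, smul_apply, smul_eq_mul, coord_apply]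
  simp only [dev_apply _ v, topGap_apply v, lowGap_apply v, Fin.sum_univ_four]
  simp only [coef, reduceIte, Fin.isValue, Fin.reduceEq]
  linear_combination (√2 / 8 * (√2 / 2 * (v 0 + v 1 - v 2 - v 3))) * key
    + (1 / 16 * ((Real.arctan (Real.exp (lowGap x)) * Real.sinh (dev 0 x)
        - Real.artanh (Real.exp (lowGap x)) * Real.cosh (dev 0 x)) * (v 1 + v 2 + v 3 - 3 * v 0)
      + (Real.arctan (Real.exp (lowGap x)) * Real.sinh (dev 1 x)
        - Real.artanh (Real.exp (lowGap x)) * Real.cosh (dev 1 x)) * (v 0 + v 2 + v 3 - 3 * v 1)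
      + (Real.arctan (Real.exp (lowGap x)) * Real.sinh (dev 2 x)
        - Real.artanh (Real.exp (lowGap x)) * Real.cosh (dev 2 x)) * (v 0 + v 1 + v 3 - 3 * v 2)
      + (Real.arctan (Real.exp (lowGap x)) * Real.sinh (dev 3 x)
        - Real.artanh (Real.exp (lowGap x)) * Real.cosh (dev 3 x)) * (v 0 + v 1 + v 2 - 3 * v 3))
      + 1 / 8 * Real.cosh (topGap x) * (v 0 + v 1 - v 2 - v 3)
      - 1 / 4 * Real.cosh (topGap x) * (v 3 - v 2)) * h2

theorem hasFDerivAt_gradForm {x : Fin 4 → ℝ} (hx : lowGap x < 0) (i : Fin 4) :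
    HasFDerivAt (gradForm i) (∑ j, hessForm i j x • coord j) x := by
  have h2 : √2 * √2 = 2 := Real.mul_self_sqrt (by norm_num)
  have hA := hasFDerivAt_arctan_exp_lowGap x
  have hB := hasFDerivAt_artanh_exp_lowGap hx
  have h := (((((topGap.hasFDerivAt (x := x)).cosh.sub_const 1).const_mul (1 / 4)).mul_const
    (coef i 3)).const_add (1 / 4)).add
    ((HasFDerivAt.fun_sum (u := Finset.univ) fun k _ =>
      ((hA.mul ((dev k).hasFDerivAt (x := x)).sinh).sub
        (hB.mul ((dev k).hasFDerivAt (x := x)).cosh)).const_mul (coef i k)).const_mul (1 / 8))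
  refine h.congr_fderiv ?_
  have key := sum_dev_deriv_grad hx i
  ext1 v
  simp only [Fin.sum_univ_four] at key
  simp only [Fin.sum_univ_four, hessForm, add_apply,
    sub_apply, smul_apply, smul_eq_mul, coord_apply]
  simp only [dev_apply _ v, topGap_apply v, lowGap_apply v, Fin.sum_univ_four]
  generalize pairSign i = e at key ⊢
  simp only [pairSign, Fin.isValue, Fin.reduceLE, reduceIte]
  generalize wallTerm x = W at key ⊢
  fin_cases i <;>
  simp only [coef, reduceIte, Fin.isValue, Fin.reduceEq, Fin.reduceFinMk, Fin.zero_eta,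
    Fin.mk_one] at key ⊢
  all_goals linear_combination (1 / 8 * (√2 / 2 * (v 0 + v 1 - v 2 - v 3))) * key
    + (1 / 2 * W * e * (v 0 + v 1 - v 2 - v 3)) * h2

/-! ### Geometry of the chamber -/

/-- The closed chamber. -/
def closedChamber : Set (Fin 4 → ℝ) := {x | x 0 ≤ x 1 ∧ x 1 ≤ x 2 ∧ x 2 ≤ x 3}

theorem isOpen_weylChamber : IsOpen weylChamber := by
  have h : ∀ i j : Fin 4, IsOpen {x : Fin 4 → ℝ | x i < x j} := fun i j =>
    isOpen_lt (continuous_apply i) (continuous_apply j)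
  exact (h 0 1).inter ((h 1 2).inter (h 2 3))

theorem isClosed_closedChamber : IsClosed closedChamber := by
  have h : ∀ i j : Fin 4, IsClosed {x : Fin 4 → ℝ | x i ≤ x j} := fun i j =>
    isClosed_le (continuous_apply i) (continuous_apply j)
  exact (h 0 1).inter ((h 1 2).inter (h 2 3))

theorem convex_weylChamber : Convex ℝ weylChamber := by
  rintro x ⟨h1, h2, h3⟩ y ⟨k1, k2, k3⟩ a b ha hb hab
  have key : ∀ p q r s : ℝ, p < q → r < s → a * p + b * r < a * q + b * s := by
    intro p q r s hpq hrs
    rcases ha.eq_or_lt with rfl | ha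
    · obtain rfl : b = 1 := by linarith
      linarith
    · have := mul_lt_mul_of_pos_left hpq ha
      have := mul_le_mul_of_nonneg_left hrs.le hb
      linarith
  exact ⟨key _ _ _ _ h1 k1, key _ _ _ _ h2 k2, key _ _ _ _ h3 k3⟩

theorem weylChamber_subset_closedChamber : weylChamber ⊆ closedChamber :=
  fun _ h => ⟨h.1.le, h.2.1.le, h.2.2.le⟩

theorem closure_weylChamber : closure weylChamber = closedChamber := by
  apply (closure_minimal weylChamber_subset_closedChamber isClosed_closedChamber).antisymm
  rintro x ⟨h1, h2, h3⟩
  -- The direction (0, 1, 2, 3) is strictly increasing, so it separates ties.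
  have hc : Tendsto (fun t : ℝ => x + t • (fun i : Fin 4 => (i : ℝ))) (𝓝[>] 0) (𝓝 x) := by
    have : Continuous (fun t : ℝ => x + t • (fun i : Fin 4 => (i : ℝ))) := by fun_prop
    have h := this.tendsto 0
    simp only [zero_smul, add_zero] at h
    exact h.mono_left nhdsWithin_le_nhds
  refine mem_closure_of_tendsto hc (eventually_nhdsWithin_of_forall fun t (ht : 0 < t) => ?_)
  refine ⟨?_, ?_, ?_⟩ <;> simp <;> linarith

theorem lowGap_neg {x : Fin 4 → ℝ} (hx : x ∈ weylChamber) : lowGap x < 0 := by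
  obtain ⟨h1, h2, h3⟩ := hx
  rw [lowGap_apply]
  have : 0 < √2 := by positivity
  exact mul_neg_of_pos_of_neg (by positivity) (by linarith)

theorem lowGap_nonpos {x : Fin 4 → ℝ} (hx : x ∈ closedChamber) : lowGap x ≤ 0 := by
  obtain ⟨h1, h2, h3⟩ := hx
  rw [lowGap_apply]
  exact mul_nonpos_of_nonneg_of_nonpos (by positivity) (by linarith)

theorem abs_dev_le {x : Fin 4 → ℝ} (hx : x ∈ closedChamber) (k : Fin 4) :
    |dev k x| ≤ -(3 * lowGap x) := by
  obtain ⟨h1, h2, h3⟩ := hx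
  have h : |∑ i, x i - 4 * x k| ≤ 3 * (x 2 + x 3 - x 0 - x 1) := by
    rw [abs_le, Fin.sum_univ_four]
    fin_cases k <;> constructor <;> simp <;> linarith
  rw [dev_apply, lowGap_apply, abs_mul, abs_of_nonneg (by positivity)]
  have := mul_le_mul_of_nonneg_left h (by positivity : 0 ≤ √2 / 2)
  linarith

theorem abs_crossGap_le {x : Fin 4 → ℝ} (hx : x ∈ closedChamber) : |crossGap x| ≤ -lowGap x := by
  obtain ⟨h1, h2, h3⟩ := hx
  have h : |x 0 - x 1 + x 2 - x 3| ≤ -(x 0 + x 1 - x 2 - x 3) := by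
    rw [abs_le]; constructor <;> linarith
  rw [crossGap_apply, lowGap_apply, abs_mul, abs_of_nonneg (by positivity)]
  have := mul_le_mul_of_nonneg_left h (by positivity : 0 ≤ √2 / 2)
  linarith

theorem abs_innerGap_le {x : Fin 4 → ℝ} (hx : x ∈ closedChamber) : |innerGap x| ≤ -lowGap x := by
  obtain ⟨h1, h2, h3⟩ := hx
  have h : |-x 0 + x 1 + x 2 - x 3| ≤ -(x 0 + x 1 - x 2 - x 3) := by
    rw [abs_le]; constructor <;> linarith
  rw [innerGap_apply, lowGap_apply, abs_mul, abs_of_nonneg (by positivity)]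
  have := mul_le_mul_of_nonneg_left h (by positivity : 0 ≤ √2 / 2)
  linarith

/-! ### Continuity up to the boundary -/

theorem Real.abs_sinh_le_of_abs_le {s t : ℝ} (h : |s| ≤ t) : |Real.sinh s| ≤ Real.sinh t := by
  rw [Real.abs_sinh]
  exact Real.sinh_le_sinh.2 h

theorem Real.cosh_sub_one_le_sinh_abs (s : ℝ) : |Real.cosh s - 1| ≤ Real.sinh |s| := by
  rw [abs_of_nonneg (by linarith [Real.one_le_cosh s]), ← Real.cosh_abs]
  have h1 := Real.cosh_sub_sinh |s|
  have h2 : Real.exp (-|s|) ≤ 1 := Real.exp_le_one_iff.2 (by simp)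
  linarith

/-- The triple-angle formula extracts a factor sinh(`lowGap`) from the bound, and this factor beats
the logarithmic singularity of artanh. -/
theorem continuousOn_artanh_exp_mul {f : (Fin 4 → ℝ) → ℝ} (hf : Continuous f)
    (hb : ∀ x ∈ closedChamber, |f x| ≤ Real.sinh (-(3 * lowGap x))) :
    ContinuousOn (fun x => Real.artanh (Real.exp (lowGap x)) * f x) closedChamber := by
  intro x hx
  rcases (lowGap_nonpos hx).lt_or_eq with h | h
  · exact (((hasFDerivAt_artanh_exp_lowGap h).continuousAt).mul hf.continuousAt).continuousWithinAt
  have hw : Tendsto (fun y => lowGap y) (𝓝[closedChamber] x) (𝓝[≤] 0) :=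
    tendsto_nhdsWithin_iff.2 ⟨by simpa only [h] using (lowGap.continuous.continuousWithinAt (x := x)).tendsto,
      eventually_nhdsWithin_of_forall fun y hy => lowGap_nonpos hy⟩
  have hg := (tendsto_artanh_exp_mul_sinh.comp hw).abs.mul
    (((Real.continuous_sinh.comp lowGap.continuous).pow 2 |>.const_mul 4 |>.add_const 3
      |>.continuousWithinAt (s := closedChamber) (x := x)))
  -- Mathlib sets artanh 1 = 0; the bound `hb` forces `f x = 0` here as well.
  have h0 : Real.artanh (Real.exp (lowGap x)) * f x = 0 := by simp [h, Real.artanh_eq_zero_iff]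
  rw [ContinuousWithinAt, h0]
  simp only [abs_zero, zero_mul] at hg
  refine squeeze_zero_norm' (eventually_nhdsWithin_of_forall fun y hy => ?_) hg
  rw [Real.norm_eq_abs, abs_mul]
  have h3 : Real.sinh (-(3 * lowGap y)) = |Real.sinh (lowGap y)|
      * (4 * Real.sinh (lowGap y) ^ 2 + 3) := by
    rw [abs_of_nonpos (Real.sinh_nonpos_iff.2 (lowGap_nonpos hy)), Real.sinh_neg,
      Real.sinh_three_mul]
    ring
  calc _ ≤ |Real.artanh (Real.exp (lowGap y))| * (|Real.sinh (lowGap y)|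
      * (4 * Real.sinh (lowGap y) ^ 2 + 3)) := by
        gcongr; exact h3 ▸ hb y hy
    _ = _ := by simp [abs_mul, mul_assoc]

theorem continuousOn_artanh_mul_sinh_dev (k : Fin 4) :
    ContinuousOn (fun x => Real.artanh (Real.exp (lowGap x)) * Real.sinh (dev k x))
      closedChamber :=
  continuousOn_artanh_exp_mul (by fun_prop) fun _ hx => Real.abs_sinh_le_of_abs_le (abs_dev_le hx k)

theorem continuousOn_artanh_mul_cosh_dev (k : Fin 4) :
    ContinuousOn (fun x => Real.artanh (Real.exp (lowGap x)) * (Real.cosh (dev k x) - 1))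
      closedChamber :=
  continuousOn_artanh_exp_mul (by fun_prop) fun x hx =>
    (Real.cosh_sub_one_le_sinh_abs _).trans (Real.sinh_le_sinh.2 (abs_dev_le hx k))

theorem continuousOn_wallTerm : ContinuousOn wallTerm closedChamber := by
  have hq : ContinuousOn (fun x => Real.sinh (crossGap x) * Real.sinh (innerGap x)
      / Real.sinh (lowGap x)) closedChamber := by
    intro x hx
    rcases (lowGap_nonpos hx).lt_or_eq with h | h
    · have : Real.sinh (lowGap x) ≠ 0 := (Real.sinh_neg_iff.2 h).ne
      exact ContinuousAt.continuousWithinAt (ContinuousAt.div (by fun_prop) (by fun_prop) this)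
    have hi : innerGap x = 0 := by simpa [h] using abs_innerGap_le hx
    have hg : Tendsto (fun y => |Real.sinh (innerGap y)|) (𝓝[closedChamber] x) (𝓝 0) := by
      have : Continuous (fun y => |Real.sinh (innerGap y)|) := by fun_prop
      simpa [hi] using (this.continuousWithinAt (x := x) (s := closedChamber)).tendsto
    have h0 : Real.sinh (crossGap x) * Real.sinh (innerGap x) / Real.sinh (lowGap x) = 0 := by
      simp [h]
    rw [ContinuousWithinAt, h0]
    refine squeeze_zero_norm' (eventually_nhdsWithin_of_forall fun y hy => ?_) hg
    have hb := Real.abs_sinh_le_of_abs_le (abs_crossGap_le hy)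
    have hs : Real.sinh (-lowGap y) = |Real.sinh (lowGap y)| := by
      rw [abs_of_nonpos (Real.sinh_nonpos_iff.2 (lowGap_nonpos hy)), Real.sinh_neg]
    rw [Real.norm_eq_abs, abs_div, abs_mul]
    exact div_le_of_le_mul₀ (abs_nonneg _) (abs_nonneg _)
      (by rw [mul_comm]; exact mul_le_mul_of_nonneg_left (hb.trans hs.le) (abs_nonneg _))
  have hc : ∀ x, Real.cosh (lowGap x) ≠ 0 := fun x => (Real.cosh_pos _).ne'
  have h1 : Continuous (fun x => Real.sinh (lowGap x) / Real.cosh (lowGap x)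
      * Real.cosh (crossGap x) * Real.cosh (innerGap x)) := by fun_prop (disch := exact hc _)
  have h2 : Continuous (fun x => Real.cosh (lowGap x)) := by fun_prop
  have h3 : Continuous (fun x => Real.sinh (topGap x)) := by fun_prop
  exact ((h1.continuousOn.add (h2.continuousOn.mul hq)).add h3.continuousOn).const_mul _

theorem continuousOn_valueForm : ContinuousOn valueForm closedChamber := by
  have h1 : Continuous (fun x : Fin 4 → ℝ => x 3 - √2 / 4 * Real.sinh (topGap x)) := by fun_prop
  refine h1.continuousOn.add (ContinuousOn.const_mul (continuousOn_finsetSum _ fun k _ => ?_) _)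
  have h2 : Continuous (fun x => Real.arctan (Real.exp (lowGap x)) * Real.cosh (dev k x)) := by
    fun_prop
  exact h2.continuousOn.sub (continuousOn_artanh_mul_sinh_dev k)

theorem continuousOn_gradForm (i : Fin 4) : ContinuousOn (gradForm i) closedChamber := by
  have h1 : Continuous (fun x => 1 / 4 + 1 / 4 * (Real.cosh (topGap x) - 1) * coef i 3) := by
    fun_prop
  have h3 : ContinuousOn (fun x => ∑ k, coef i k *
      (Real.arctan (Real.exp (lowGap x)) * Real.sinh (dev k x)
        - Real.artanh (Real.exp (lowGap x)) * (Real.cosh (dev k x) - 1))) closedChamber := by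
    refine continuousOn_finsetSum _ fun k _ => ContinuousOn.const_mul ?_ _
    have h2 : Continuous (fun x => Real.arctan (Real.exp (lowGap x)) * Real.sinh (dev k x)) := by
      fun_prop
    exact h2.continuousOn.sub (continuousOn_artanh_mul_cosh_dev k)
  refine (h1.continuousOn.add (h3.const_mul (1 / 8))).congr fun x _ => ?_
  -- Each artanh · cosh term diverges by itself; the zero sum allows cosh to be replaced by cosh -
  -- 1.
  have hs : coef i 0 + coef i 1 + coef i 2 + coef i 3 = 0 := by
    fin_cases i <;> simp [coef] <;> norm_num
  simp only [gradForm, Fin.sum_univ_four, Pi.add_apply]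
  linear_combination -(1 / 8 * Real.artanh (Real.exp (lowGap x))) * hs

theorem continuousOn_hessForm (i j : Fin 4) : ContinuousOn (hessForm i j) closedChamber := by
  have h1 : Continuous (fun x => √2 / 8 * Real.sinh (topGap x) * (coef i 3 * coef j 3)) := by
    fun_prop
  refine ContinuousOn.add (ContinuousOn.sub (ContinuousOn.const_mul
    (continuousOn_finsetSum _ fun k _ => ContinuousOn.const_mul ?_ _) _) h1.continuousOn)
    (continuousOn_wallTerm.mul continuousOn_const)
  have h2 : Continuous (fun x => Real.arctan (Real.exp (lowGap x)) * Real.cosh (dev k x)) := by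
    fun_prop
  exact h2.continuousOn.sub (continuousOn_artanh_mul_sinh_dev k)

/-- A function with derivative `∑ g_j dx_j` on the open chamber has that derivative up to the
boundary as soon as everything is continuous there. -/
theorem hasFDerivWithinAt_closedChamber {f : (Fin 4 → ℝ) → ℝ} {g : Fin 4 → (Fin 4 → ℝ) → ℝ}
    (hd : ∀ x ∈ weylChamber, HasFDerivAt f (∑ j, g j x • coord j) x)
    (hf : ContinuousOn f closedChamber) (hg : ∀ j, ContinuousOn (g j) closedChamber)
    {x : Fin 4 → ℝ} (hx : x ∈ closedChamber) :
    HasFDerivWithinAt f (∑ j, g j x • coord j) closedChamber x := by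
  rw [← closure_weylChamber] at hf hg hx ⊢
  refine hasFDerivWithinAt_closure_of_tendsto_fderiv
    (fun y hy => (hd y hy).differentiableAt.differentiableWithinAt) convex_weylChamber
    isOpen_weylChamber (fun y hy => (hf y hy).mono subset_closure) ?_
  have h : ContinuousOn (fun y => ∑ j, g j y • coord j) (closure weylChamber) :=
    continuousOn_finsetSum _ fun j _ => (hg j).smul continuousOn_const
  exact ((h x hx).mono subset_closure).congr' (eventually_nhdsWithin_of_forall fun y hy =>
    (hd y hy).fderiv.symm)

theorem hasFDerivWithinAt_valueForm {x : Fin 4 → ℝ} (hx : x ∈ closedChamber) :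
    HasFDerivWithinAt valueForm (∑ j, gradForm j x • coord j) closedChamber x :=
  hasFDerivWithinAt_closedChamber (fun _ hy => hasFDerivAt_valueForm (lowGap_neg hy))
    continuousOn_valueForm continuousOn_gradForm hx

theorem hasFDerivWithinAt_gradForm (i : Fin 4) {x : Fin 4 → ℝ} (hx : x ∈ closedChamber) :
    HasFDerivWithinAt (gradForm i) (∑ j, hessForm i j x • coord j) closedChamber x :=
  hasFDerivWithinAt_closedChamber (fun _ hy => hasFDerivAt_gradForm (lowGap_neg hy) i)
    (continuousOn_gradForm i) (continuousOn_hessForm i) hx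

/-! ### Ranking and equivariant extensions -/

theorem monotone_iff_mem_closedChamber {x : Fin 4 → ℝ} : Monotone x ↔ x ∈ closedChamber := by
  rw [Fin.monotone_iff_le_succ, Fin.forall_fin_succ, Fin.forall_fin_two]
  rfl

theorem ranked_mem_closedChamber (x : Fin 4 → ℝ) : ranked x ∈ closedChamber :=
  monotone_iff_mem_closedChamber.1 (Tuple.monotone_sort x)

theorem ranked_comp_perm (x : Fin 4 → ℝ) (σ : Equiv.Perm (Fin 4)) :
    ranked (x ∘ σ) = ranked x :=
  Tuple.comp_perm_comp_sort_eq_comp_sort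

theorem ranked_eq_self {x : Fin 4 → ℝ} (hx : x ∈ closedChamber) : ranked x = x := by
  rw [ranked, Tuple.sort_eq_refl_iff_monotone.2 (monotone_iff_mem_closedChamber.2 hx)]
  rfl

theorem dev_comp_perm (x : Fin 4 → ℝ) (σ : Equiv.Perm (Fin 4)) (k : Fin 4) :
    dev k (x ∘ σ) = dev (σ k) x := by
  simp only [dev_apply, Function.comp_apply, Equiv.sum_comp σ x]

theorem coef_perm (σ : Equiv.Perm (Fin 4)) (i k : Fin 4) : coef (σ i) (σ k) = coef i k := by
  simp [coef]

/-- The permutation-equivariant extension of `gradForm` from the closed chamber to `ℝ⁴`. -/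
noncomputable def symmGrad (i : Fin 4) (x : Fin 4 → ℝ) : ℝ :=
  1 / 4 + 1 / 4 * (Real.cosh (topGap (ranked x)) - 1) * (if x i = ranked x 3 then -3 else 1)
    + 1 / 8 * ∑ k, coef i k * (Real.arctan (Real.exp (lowGap (ranked x))) * Real.sinh (dev k x)
        - Real.artanh (Real.exp (lowGap (ranked x))) * Real.cosh (dev k x))

/-- The permutation-equivariant extension of `hessForm` from the closed chamber to `ℝ⁴`. -/
noncomputable def symmHess (i j : Fin 4) (x : Fin 4 → ℝ) : ℝ :=
  √2 / 16 * (∑ k, coef i k * coef j k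
      * (Real.arctan (Real.exp (lowGap (ranked x))) * Real.cosh (dev k x)
        - Real.artanh (Real.exp (lowGap (ranked x))) * Real.sinh (dev k x)))
    - √2 / 8 * Real.sinh (topGap (ranked x))
      * ((if x i = ranked x 3 then -3 else 1) * (if x j = ranked x 3 then -3 else 1))
    + wallTerm (ranked x)
      * ((if ranked x 2 ≤ x i then -1 else 1) * (if ranked x 2 ≤ x j then -1 else 1))

theorem symmU_comp_perm (x : Fin 4 → ℝ) (σ : Equiv.Perm (Fin 4)) : symmU (x ∘ σ) = symmU x := by
  rw [symmU, ranked_comp_perm, symmU]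

theorem symmGrad_comp_perm (i : Fin 4) (x : Fin 4 → ℝ) (σ : Equiv.Perm (Fin 4)) :
    symmGrad i (x ∘ σ) = symmGrad (σ i) x := by
  simp only [symmGrad, ranked_comp_perm, dev_comp_perm, Function.comp_apply]
  congr 2
  refine Eq.trans ?_ (Equiv.sum_comp σ _)
  simp only [coef_perm]

theorem symmHess_comp_perm (i j : Fin 4) (x : Fin 4 → ℝ) (σ : Equiv.Perm (Fin 4)) :
    symmHess i j (x ∘ σ) = symmHess (σ i) (σ j) x := by
  simp only [symmHess, ranked_comp_perm, dev_comp_perm, Function.comp_apply]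
  congr 3
  refine Eq.trans ?_ (Equiv.sum_comp σ _)
  simp only [coef_perm]

theorem symmU_eq_valueForm {x : Fin 4 → ℝ} (hx : x ∈ closedChamber) : symmU x = valueForm x := by
  rw [symmU, ranked_eq_self hx, chamberU_eq_valueForm]

theorem eq_top_iff_of_topGap_ne {x : Fin 4 → ℝ} (hx : x ∈ closedChamber) (h : x 2 ≠ x 3)
    (i : Fin 4) : x i = x 3 ↔ i = 3 := by
  obtain ⟨h1, h2, h3⟩ := hx
  have h4 := h3.lt_of_ne h
  fin_cases i <;> simp <;> linarith

theorem symmGrad_eq_gradForm {x : Fin 4 → ℝ} (hx : x ∈ closedChamber) (i : Fin 4) :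
    symmGrad i x = gradForm i x := by
  simp only [symmGrad, gradForm, ranked_eq_self hx, add_left_inj, add_right_inj]
  by_cases h : x 2 = x 3
  · simp [topGap_apply, h]
  · simp only [eq_top_iff_of_topGap_ne hx h, coef]

/-- On this wall `crossGap` equals `lowGap`, and the three summands cancel by the addition formula
for sinh. -/
theorem wallTerm_eq_zero {x : Fin 4 → ℝ} (hx : x ∈ closedChamber) (h : x 1 = x 2) :
    wallTerm x = 0 := by
  have hc : crossGap x = lowGap x := by rw [crossGap_apply, lowGap_apply, h]; ring
  have ht : topGap x = -(lowGap x + innerGap x) := by rw [topGap_eq, hc]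
  rw [wallTerm, ht, hc, Real.sinh_neg, Real.sinh_add]
  have h0 : Real.cosh (lowGap x) ≠ 0 := (Real.cosh_pos _).ne'
  by_cases h1 : Real.sinh (lowGap x) = 0
  · have h2 : lowGap x = 0 := Real.sinh_eq_zero.1 h1
    have hi : innerGap x = 0 := by simpa [h2] using abs_innerGap_le hx
    simp [h2, hi]
  · field_simp
    ring

theorem symmHess_eq_hessForm {x : Fin 4 → ℝ} (hx : x ∈ closedChamber) (i j : Fin 4) :
    symmHess i j x = hessForm i j x := by
  simp only [symmHess, hessForm, ranked_eq_self hx]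
  congr 1
  · congr 1
    by_cases h : x 2 = x 3
    · simp [topGap_apply, h]
    · simp only [eq_top_iff_of_topGap_ne hx h, coef]
  · by_cases h : x 1 = x 2
    · simp [wallTerm_eq_zero hx h]
    · have key : ∀ k : Fin 4, x 2 ≤ x k ↔ 2 ≤ k := by
        obtain ⟨h1, h2, h3⟩ := hx
        have h4 := h2.lt_of_ne h
        intro k
        fin_cases k <;> simp <;> linarith
      simp only [key, pairSign]

/-! ### Gluing the 24 cells -/

/-- The action of a permutation on coordinates as a linear map. -/
noncomputable def permCoord (σ : Equiv.Perm (Fin 4)) : (Fin 4 → ℝ) →L[ℝ] (Fin 4 → ℝ) :=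
  ContinuousLinearMap.pi fun i => coord (σ i)

theorem permCoord_apply (σ : Equiv.Perm (Fin 4)) (x : Fin 4 → ℝ) : permCoord σ x = x ∘ σ := rfl

theorem iUnion_permCoord_preimage_closedChamber :
    ⋃ σ, permCoord σ ⁻¹' closedChamber = Set.univ :=
  Set.eq_univ_of_forall fun x => Set.mem_iUnion.2 ⟨Tuple.sort x, ranked_mem_closedChamber x⟩

theorem comp_perm_comp_inv (x : Fin 4 → ℝ) (σ : Equiv.Perm (Fin 4)) :
    (x ∘ σ) ∘ σ.symm = x := by
  ext i; simp

theorem continuous_of_continuousOn_comp_perm {f : (Fin 4 → ℝ) → ℝ}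
    (h : ∀ σ : Equiv.Perm (Fin 4), ContinuousOn (fun y => f (y ∘ σ)) closedChamber) :
    Continuous f := by
  refine (locallyFinite_of_finite _).continuous iUnion_permCoord_preimage_closedChamber
    (fun σ => isClosed_closedChamber.preimage (permCoord σ).continuous) fun σ => ?_
  have := (h σ.symm).comp (permCoord σ).continuous.continuousOn (Set.mapsTo_preimage _ _)
  exact this.congr fun x _ => by simp [permCoord_apply, comp_perm_comp_inv]

/-- Differentiability on `ℝ⁴` may be checked on the 24 images of the closed chamber. -/
theorem hasFDerivAt_of_hasFDerivWithinAt_comp_perm {f : (Fin 4 → ℝ) → ℝ}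
    {g : Fin 4 → (Fin 4 → ℝ) → ℝ}
    (h : ∀ σ : Equiv.Perm (Fin 4), ∀ x ∈ closedChamber,
      HasFDerivWithinAt (fun y => f (y ∘ σ)) (∑ j, g j (x ∘ σ) • coord (σ j)) closedChamber x)
    (x : Fin 4 → ℝ) : HasFDerivAt f (∑ j, g j x • coord j) x := by
  have hcell : ∀ σ : Equiv.Perm (Fin 4),
      HasFDerivWithinAt f (∑ j, g j x • coord j) (permCoord σ ⁻¹' closedChamber) x := by
    intro σ
    by_cases hx : x ∈ permCoord σ ⁻¹' closedChamber
    · have h1 := (h σ.symm (permCoord σ x) hx).comp x (permCoord σ).hasFDerivWithinAt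
        (Set.mapsTo_preimage _ _)
      have h2 : (fun y => f (y ∘ σ.symm)) ∘ permCoord σ = f := by
        ext y; simp [permCoord_apply, comp_perm_comp_inv]
      rw [h2] at h1
      refine h1.congr_fderiv ?_
      ext1 v
      simp [permCoord_apply, comp_perm_comp_inv]
    · refine HasFDerivWithinAt.of_notMem_closure ?_
      rwa [(isClosed_closedChamber.preimage (permCoord σ).continuous).closure_eq]
  rw [← hasFDerivWithinAt_univ, ← iUnion_permCoord_preimage_closedChamber]
  -- The union of cells is finite, so its neighbourhood filter is the supremum of those of the
  -- cells.
  simp only [hasFDerivWithinAt_iff_isLittleO, nhdsWithin_iUnion, Asymptotics.isLittleO_iff,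
    eventually_iSup] at hcell ⊢
  exact fun c hc σ => hcell σ hc

theorem hasFDerivAt_symmU (x : Fin 4 → ℝ) :
    HasFDerivAt symmU (∑ j, symmGrad j x • coord j) x := by
  refine hasFDerivAt_of_hasFDerivWithinAt_comp_perm (fun σ x hx => ?_) x
  simp only [symmU_comp_perm, symmGrad_comp_perm]
  rw [Equiv.sum_comp σ fun j => symmGrad j x • coord j]
  simp only [symmGrad_eq_gradForm hx]
  exact (hasFDerivWithinAt_valueForm hx).congr (fun y hy => symmU_eq_valueForm hy)
    (symmU_eq_valueForm hx)

theorem hasFDerivAt_symmGrad (i : Fin 4) (x : Fin 4 → ℝ) :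
    HasFDerivAt (symmGrad i) (∑ j, symmHess i j x • coord j) x := by
  refine hasFDerivAt_of_hasFDerivWithinAt_comp_perm (fun σ x hx => ?_) x
  simp only [symmGrad_comp_perm, symmHess_comp_perm]
  rw [Equiv.sum_comp σ fun j => symmHess (σ i) j x • coord j]
  simp only [symmHess_eq_hessForm hx]
  exact (hasFDerivWithinAt_gradForm (σ i) hx).congr (fun y hy => symmGrad_eq_gradForm hy _)
    (symmGrad_eq_gradForm hx _)

theorem continuous_symmHess (i j : Fin 4) : Continuous (symmHess i j) :=
  continuous_of_continuousOn_comp_perm fun σ => by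
    simp only [symmHess_comp_perm]
    exact (continuousOn_hessForm _ _).congr fun y hy => symmHess_eq_hessForm hy _ _

theorem contDiff_symmU : ContDiff ℝ 2 symmU := by
  have h1 : ∀ i, ContDiff ℝ 1 (symmGrad i) := fun i =>
    contDiff_one_iff_hasFDerivAt.2 ⟨_, continuous_finsetSum _ fun j _ =>
      (continuous_symmHess i j).smul continuous_const, hasFDerivAt_symmGrad i⟩
  have h2 : ContDiff ℝ ((1 : ℕ) + 1) symmU := contDiff_succ_iff_hasFDerivAt.2
    ⟨_, ContDiff.sum fun j _ => (h1 j).smul contDiff_const, hasFDerivAt_symmU⟩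
  exact h2.of_le (by norm_num [one_add_one_eq_two])

/-! ### Wall conditions and the equation -/

theorem symmU_eq_chamberU {x : Fin 4 → ℝ} (hx : x ∈ weylChamber) : symmU x = chamberU x := by
  rw [symmU, ranked_eq_self (weylChamber_subset_closedChamber hx)]

theorem uniqueDiffOn_closure_weylChamber : UniqueDiffOn ℝ (closure weylChamber) := by
  refine uniqueDiffOn_convex convex_weylChamber.closure ⟨fun i => (i : ℝ), ?_⟩
  refine interior_mono subset_closure ?_
  rw [isOpen_weylChamber.interior_eq]
  refine ⟨?_, ?_, ?_⟩ <;> norm_num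

theorem partialWithin_symmU {x : Fin 4 → ℝ} (hx : x ∈ closure weylChamber) (i : Fin 4) :
    partialWithin (closure weylChamber) symmU i x = symmGrad i x := by
  rw [partialWithin, (hasFDerivAt_symmU x).hasFDerivWithinAt.fderivWithin
    (uniqueDiffOn_closure_weylChamber x hx)]
  simp [Pi.single_apply]

theorem symmGrad_congr {x : Fin 4 → ℝ} {i j : Fin 4} (h : x i = x j) :
    symmGrad i x = symmGrad j x := by
  have hx : x ∘ Equiv.swap i j = x := by
    ext k
    rcases eq_or_ne k i with rfl | hi
    · simp [h]
    rcases eq_or_ne k j with rfl | hj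
    · simp [h]
    simp [Equiv.swap_apply_of_ne_of_ne hi hj]
  have := symmGrad_comp_perm i x (Equiv.swap i j)
  rwa [hx, Equiv.swap_apply_left] at this

theorem hessianMatrix_chamberU {x : Fin 4 → ℝ} (hx : x ∈ weylChamber) (i j : Fin 4) :
    hessianMatrix chamberU x i j = hessForm j i x := by
  have h : ∀ y ∈ weylChamber, fderiv ℝ chamberU y (Pi.single j 1) = gradForm j y := by
    intro y hy
    rw [funext chamberU_eq_valueForm, (hasFDerivAt_valueForm (lowGap_neg hy)).fderiv]
    simp [Pi.single_apply]
  have he : (fun y => fderiv ℝ chamberU y (Pi.single j 1)) =ᶠ[𝓝 x] gradForm j := by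
    filter_upwards [isOpen_weylChamber.mem_nhds hx] with y hy using h y hy
  simp only [hessianMatrix, Matrix.of_apply]
  rw [he.fderiv_eq, (hasFDerivAt_gradForm (lowGap_neg hx) j).fderiv]
  simp [Pi.single_apply]

theorem maxCoord_eq {x : Fin 4 → ℝ} (hx : x ∈ weylChamber) : maxCoord x = x 3 := by
  have hm := monotone_iff_mem_closedChamber.2 (weylChamber_subset_closedChamber hx)
  exact le_antisymm (Finset.sup'_le _ _ fun i _ => hm (Fin.le_last i))
    (Finset.le_sup' x (Finset.mem_univ 3))

theorem chamberU_sub_maxCoord {x : Fin 4 → ℝ} (hx : x ∈ weylChamber) :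
    chamberU x - maxCoord x
      - 1 / 2 * (indicatorVec {1, 3} ⬝ᵥ (hessianMatrix chamberU x *ᵥ indicatorVec {1, 3})) = 0 := by
  have h : indicatorVec {1, 3} ⬝ᵥ (hessianMatrix chamberU x *ᵥ indicatorVec {1, 3})
      = hessForm 1 1 x + hessForm 1 3 x + (hessForm 3 1 x + hessForm 3 3 x) := by
    simp [indicatorVec, Matrix.mulVec_add, hessianMatrix_chamberU hx]
  rw [h, maxCoord_eq hx, chamberU_eq_valueForm]
  -- `pairSign 1 + pairSign 3 = 0` removes `wallTerm`, and `coef 1 k + coef 3 k = ±2` has square 4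
  -- for every `k`, which reproduces `valueForm` minus `x 3`.
  simp only [valueForm, hessForm, Fin.sum_univ_four, coef, pairSign, Fin.isValue, Fin.reduceEq,
    Fin.reduceLE, reduceIte]
  ring

theorem proposition6p1 :
    (∃ V : (Fin 4 → ℝ) → ℝ,
      Set.EqOn V chamberU weylChamber ∧
      ContDiffOn ℝ 2 V (closure weylChamber) ∧
      (∀ i : Fin 3, ∀ x ∈ closure weylChamber, x i.castSucc = x i.succ →
        partialWithin (closure weylChamber) V i.castSucc x
          = partialWithin (closure weylChamber) V i.succ x) ∧
      (∀ x : Fin 4 → ℝ, symmU x = V (ranked x))) ∧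
    ContDiff ℝ 2 symmU ∧
    (∀ x ∈ weylChamber,
      chamberU x - maxCoord x
        - 1 / 2 * (indicatorVec {1, 3} ⬝ᵥ (hessianMatrix chamberU x *ᵥ indicatorVec {1, 3}))
        = 0) := by
  refine ⟨⟨symmU, fun x hx => symmU_eq_chamberU hx, contDiff_symmU.contDiffOn,
    fun i x hx h => ?_, fun x => ?_⟩, contDiff_symmU, fun x hx => chamberU_sub_maxCoord hx⟩
  · rw [partialWithin_symmU hx, partialWithin_symmU hx, symmGrad_congr h]
  · exact (symmU_comp_perm x (Tuple.sort x)).symm
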